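/- Let $N=\mathbb Z^d$ with $d\ge 1$, and let $\mathcal P\subset N\otimes\mathbb R$ be a lattice polytope contained in the hyperplane of vectors with first coordinate $1$. Let $\mathcal A=\mathcal P\cap N=\{a_1,\dots,a_n\}$, and assume that the map $A:\mathbb Z^n\to N$, $e_i\mapsto a_i$, is surjective. Let $M=\operatorname{Hom}(N,\mathbb Z)$, let $D$ be the cokernel of the dual map $M\to\mathbb Z^n$, $m\mapsto(\langle m,a_i\rangle)_i$, and let $\Phi:\mathbb Z^n\to D$ be the projection. Let $S=\mathbb C[x_1,\dots,x_n]$ be graded by $D$ through $\deg x_i=\Phi(e_i)$. A phase $\Sigma$ is a regular triangulation of $\mathcal A$ (not every point of $\mathcal A$ has to be a vertex of it) with maximal simplices $\sigma_1,\dots,\sigma_m$. Its Cox ideal is $$B_\Sigma=\Big(\prod_{i\notin\sigma_1}x_i,\ \dots,\ \prod_{i\notin\sigma_m}x_i\Big)\subset S ,$$ where $i\in\sigma$ means that $a_i$ is a vertex of $\sigma$. The local cohomology modules $H^k_{B_\Sigma}(S)$ are $D$-graded. A vector $\delta\in D$ is called $B_\Sigma$-acyclic if $H^k_{B_\Sigma}(S)_\delta=0$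 for all $k\ge 0$. Theorem. For every such $\mathcal A$ and every phase $\Sigma$ of $\mathcal A$: 1. there are only finitely many $\delta\in D$ such that both $\delta$ and $-\delta$ are $B_\Sigma$-acyclic; 2. for every integer $T\ge 0$ there are, up to permutations of the entries and simultaneous shifts $\alpha_i\mapsto\alpha_i+c$ with $c\in D$, only finitely many families $(\alpha_1,\dots,\alpha_T)$ in $D$ such that $\alpha_i-\alpha_j$ is $B_\Sigma$-acyclic for all $i,j$. -/

import Mathlib

namespace ToricPhase

/-! ### Graded local cohomology through the Čech complex -/

section Cech

/-- The localization `S_{f_J}` at `f_J = ∏_{i ∈ J} f_i`. -/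
abbrev CechLoc {ι S : Type} [CommRing S] (f : ι → S) (J : Finset ι) : Type :=
  Localization.Away (∏ i ∈ J, f i)

theorem cechLoc_isUnit {ι S : Type} [CommRing S] (f : ι → S) {J J' : Finset ι} (h : J ⊆ J') :
    IsUnit (algebraMap S (CechLoc f J') (∏ i ∈ J, f i)) :=
  isUnit_of_dvd_unit (map_dvd _ (Finset.prod_dvd_prod_of_subset J J' f h))
    (IsLocalization.Away.algebraMap_isUnit (S := CechLoc f J') (∏ i ∈ J', f i))

/-- The canonical map `S_{f_J} → S_{f_{J'}}` for `J ⊆ J'`. -/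
noncomputable def cechRes {ι S : Type} [CommRing S] (f : ι → S) {J J' : Finset ι} (h : J ⊆ J') :
    CechLoc f J →ₐ[S] CechLoc f J' :=
  IsLocalization.liftAlgHom (M := Submonoid.powers (∏ i ∈ J, f i))
    (f := Algebra.ofId S (CechLoc f J')) (by
      rintro ⟨_, k, rfl⟩
      simpa [Algebra.ofId_apply] using (cechLoc_isUnit f h).pow k)

/-- Čech cochains of degree `p`: families `(z_J)` with `z_J ∈ S_{f_J}`, over the `p`-element sets
`J` of indices. In degree `0` this is `S` itself. -/
abbrev CechCochain {ι S : Type} [CommRing S] (f : ι → S) (p : ℕ) : Type :=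
  (J : {J : Finset ι // J.card = p}) → CechLoc f J.1

/-- The Čech differential
`(d z)_J = ∑_{i ∈ J} (-1)^{#{j ∈ J, j < i}} z_{J \ {i}}`, the sum being taken in `S_{f_J}`. -/
noncomputable def cechD {ι S : Type} [LinearOrder ι] [CommRing S] (f : ι → S) (p : ℕ) :
    CechCochain f p →ₗ[S] CechCochain f (p + 1) :=
  LinearMap.pi fun J => ∑ i : {i // i ∈ J.1},
    ((-1 : S) ^ (J.1.filter (· < i.1)).card) •
      ((cechRes f (Finset.erase_subset i.1 J.1)).toLinearMap ∘ₗ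
        LinearMap.proj (⟨J.1.erase i.1, by
          rw [Finset.card_erase_of_mem i.2, J.2, Nat.add_sub_cancel]⟩ :
            {J : Finset ι // J.card = p}))

theorem cechRes_comp {ι S : Type} [CommRing S] (f : ι → S) {J J' J'' : Finset ι} (h : J ⊆ J')
    (h' : J' ⊆ J'') (z : CechLoc f J) :
    cechRes f h' (cechRes f h z) = cechRes f (h.trans h') z := by
  have : (cechRes f h').comp (cechRes f h) = cechRes f (h.trans h') :=
    IsLocalization.algHom_ext (Submonoid.powers (∏ i ∈ J, f i)) (by ext)
  exact DFunLike.congr_fun this z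

theorem cechSign {ι : Type} [LinearOrder ι] (J : Finset ι) {i j : ι} (hi : i ∈ J) (hij : i < j) :
    ((J.erase i).filter (· < j)).card + 1 = (J.filter (· < j)).card ∧
      (J.erase j).filter (· < i) = J.filter (· < i) := by
  constructor
  · rw [Finset.filter_erase, Finset.card_erase_add_one (by simp [hi, hij])]
  · rw [Finset.filter_erase, Finset.erase_eq_of_notMem (by simp [hij.le])]

theorem cechD_comp_cechD {ι S : Type} [LinearOrder ι] [CommRing S] (f : ι → S) (p : ℕ)
    (z : CechCochain f p) : cechD f (p + 1) (cechD f p z) = 0 := by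
  funext J
  obtain ⟨J, hJ⟩ := J
  let G : Finset ι → CechLoc f J := fun K =>
    if h : K ⊆ J ∧ K.card = p then cechRes f h.1 (z ⟨K, h.2⟩) else 0
  let s : Finset ι → ι → S := fun K i => (-1 : S) ^ (K.filter (· < i)).card
  have key : (cechD f (p + 1) (cechD f p z)) ⟨J, hJ⟩ =
      ∑ i ∈ J, ∑ j ∈ J.erase i, (s J i * s (J.erase i) j) • G ((J.erase i).erase j) := by
    rw [← Finset.sum_coe_sort J]
    simp only [cechD, LinearMap.pi_apply, LinearMap.sum_apply, LinearMap.smul_apply,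
      LinearMap.comp_apply, LinearMap.proj_apply, AlgHom.toLinearMap_apply, map_sum]
    refine Finset.sum_congr rfl fun i _ => ?_
    rw [Finset.smul_sum, ← Finset.sum_coe_sort (J.erase i.1)]
    refine Finset.sum_congr rfl fun j _ => ?_
    have h : (J.erase i.1).erase j.1 ⊆ J ∧ ((J.erase i.1).erase j.1).card = p :=
      ⟨(Finset.erase_subset _ _).trans (Finset.erase_subset _ _), by
        rw [Finset.card_erase_of_mem j.2, Finset.card_erase_of_mem i.2, hJ]; rfl⟩
    simp only [G, dif_pos h, map_smul, cechRes_comp, s, mul_smul]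
  rw [key, Finset.sum_sigma']
  refine Finset.sum_involution (fun x _ => ⟨x.2, x.1⟩) ?_ ?_ ?_ ?_
  · rintro ⟨i, j⟩ h
    obtain ⟨hi, hj⟩ := Finset.mem_sigma.1 h
    obtain ⟨hne, hj⟩ := Finset.mem_erase.1 hj
    simp only at hi hj hne ⊢
    rw [Finset.erase_right_comm (a := j), ← add_smul]
    suffices h0 : s J i * s (J.erase i) j + s J j * s (J.erase j) i = 0 by rw [h0, zero_smul]
    rcases lt_or_gt_of_ne hne with hlt | hlt
    · obtain ⟨h1, h2⟩ := cechSign J hj hlt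
      simp only [s, h2, ← h1]
      ring
    · obtain ⟨h1, h2⟩ := cechSign J hi hlt
      simp only [s, h2, ← h1]
      ring
  · rintro ⟨i, j⟩ h _ heq
    have := (Finset.mem_erase.1 (Finset.mem_sigma.1 h).2).1
    simp only [Sigma.mk.injEq, heq_eq_eq] at heq
    exact this heq.1
  · rintro ⟨i, j⟩ h
    obtain ⟨hi, hj⟩ := Finset.mem_sigma.1 h
    obtain ⟨hne, hj⟩ := Finset.mem_erase.1 hj
    exact Finset.mem_sigma.2 ⟨hj, Finset.mem_erase.2 ⟨fun h => hne h.symm, hi⟩⟩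
  · rintro ⟨i, j⟩ _
    rfl

/-- Čech cocycles of degree `k`. -/
noncomputable abbrev cechCocycles {ι S : Type} [LinearOrder ι] [CommRing S] (f : ι → S) (k : ℕ) :
    Submodule S (CechCochain f k) :=
  LinearMap.ker (cechD f k)

/-- Čech coboundaries of degree `k`. -/
noncomputable def cechBoundaries {ι S : Type} [LinearOrder ι] [CommRing S] (f : ι → S) :
    (k : ℕ) → Submodule S (CechCochain f k)
  | 0 => ⊥
  | k + 1 => LinearMap.range (cechD f k)

/-- The local cohomology `H^k_B(S)` of a (noetherian) ring `S` with support in the ideal `B`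
generated by the finite family `f`: the `k`-th cohomology of the Čech complex
`0 → S → ∏ S_{f_i} → ∏ S_{f_i f_j} → ⋯`. -/
abbrev LocalCohomology {ι S : Type} [LinearOrder ι] [CommRing S] (f : ι → S) (k : ℕ) : Type :=
  cechCocycles f k ⧸ (cechBoundaries f k).submoduleOf (cechCocycles f k)

/-- The degree `δ` part of `S_g`, for `g` homogeneous of degree `e` in the `D`-graded ring
`S = ⨁ 𝒢 δ`: all fractions `a / g ^ k` with `a` homogeneous of degree `δ + k e`. -/
def awayPiece {K S D : Type} [CommRing K] [CommRing S] [Algebra K S] [AddCommGroup D]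
    (𝒢 : D → Submodule K S) [SetLike.GradedMonoid 𝒢] (g : S) (e : D) (hg : g ∈ 𝒢 e) (δ : D) :
    Submodule K (Localization.Away g) where
  carrier := {z | ∃ k : ℕ, ∃ a ∈ 𝒢 (δ + k • e),
    z = IsLocalization.mk' (Localization.Away g) a
      (⟨g ^ k, k, rfl⟩ : Submonoid.powers g)}
  zero_mem' := ⟨0, 0, Submodule.zero_mem _, by simp⟩
  add_mem' := by
    rintro _ _ ⟨k, a, ha, rfl⟩ ⟨l, b, hb, rfl⟩
    refine ⟨k + l, a * g ^ l + b * g ^ k, Submodule.add_mem _ ?_ ?_, ?_⟩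
    · have := SetLike.mul_mem_graded ha (SetLike.pow_mem_graded l hg)
      rwa [add_assoc, ← add_nsmul] at this
    · have := SetLike.mul_mem_graded hb (SetLike.pow_mem_graded k hg)
      rwa [add_assoc, ← add_nsmul, add_comm l k] at this
    · rw [← IsLocalization.mk'_add]
      congr 1
      exact Subtype.ext (pow_add g k l).symm
  smul_mem' := by
    rintro c _ ⟨k, a, ha, rfl⟩
    refine ⟨k, c • a, Submodule.smul_mem _ c ha, ?_⟩
    rw [Algebra.smul_def c a, ← IsLocalization.smul_mk', algebraMap_smul]

/-- The degree `δ` Čech cochains, for generators `f i` homogeneous of degree `e i`. -/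
def cechCochainPiece {ι K S D : Type} [CommRing K] [CommRing S] [Algebra K S] [AddCommGroup D]
    (𝒢 : D → Submodule K S) [SetLike.GradedMonoid 𝒢] (f : ι → S) (e : ι → D)
    (hf : ∀ i, f i ∈ 𝒢 (e i)) (p : ℕ) (δ : D) : Submodule K (CechCochain f p) :=
  Submodule.pi Set.univ fun J =>
    awayPiece 𝒢 (∏ i ∈ J.1, f i) (∑ i ∈ J.1, e i)
      (SetLike.prod_mem_graded 𝒢 e f fun i _ => hf i) δ

/-- The graded piece `H^k_B(S)_δ`: the classes of the cocycles that are homogeneous of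
degree `δ`. -/
noncomputable def localCohomologyPiece {ι K S D : Type} [LinearOrder ι] [CommRing K] [CommRing S]
    [Algebra K S] [AddCommGroup D]
    (𝒢 : D → Submodule K S) [SetLike.GradedMonoid 𝒢] (f : ι → S) (e : ι → D)
    (hf : ∀ i, f i ∈ 𝒢 (e i)) (k : ℕ) (δ : D) : Submodule K (LocalCohomology f k) :=
  ((cechCochainPiece 𝒢 f e hf k δ).comap
    ((cechCocycles f k).subtype.restrictScalars K)).map
    (((cechBoundaries f k).submoduleOf (cechCocycles f k)).mkQ.restrictScalars K)

end Cech

/-! ### Toric point sets and their phases -/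

/-- A vector of the lattice `N = ℤ^d`, seen in `N ⊗ ℝ = ℝ^d`. -/
def toReal {d : ℕ} (v : Fin d → ℤ) : Fin d → ℝ := fun j => (v j : ℝ)

/-- The point set `𝒜 = 𝒫 ∩ N = {a_1, …, a_n}` of a lattice polytope `𝒫` that lies in the hyperplane
of vectors with first coordinate `1` in `N ⊗ ℝ`, where `N = ℤ^d`. The polytope is the convex
hull of `𝒜`. The map `A : ℤ^n → N` given by the points is assumed to be surjective. -/
structure PointSet (d n : ℕ) [NeZero d] where
  pt : Fin n → (Fin d → ℤ)
  pt_injective : Function.Injective pt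
  height_one : ∀ i, pt i 0 = 1
  all_lattice_points : ∀ v : Fin d → ℤ,
    toReal v ∈ convexHull ℝ (Set.range fun i => toReal (pt i)) → v ∈ Set.range pt
  surjective : ∀ v : Fin d → ℤ, ∃ c : Fin n → ℤ, ∑ i, c i • pt i = v

namespace PointSet

/-- The convex hull in `N ⊗ ℝ` of the points of `𝒜` with index in `σ`. -/
def hull {d n : ℕ} [NeZero d] (𝒜 : PointSet d n) (σ : Finset (Fin n)) : Set (Fin d → ℝ) :=
  convexHull ℝ ((fun i => toReal (𝒜.pt i)) '' (σ : Set (Fin n)))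

/-- The transpose of `A`, that is the map `M → ℤ^n`, `m ↦ (⟨m, a_i⟩)_i`, on the dual lattice
`M = ℤ^d` of `N`. -/
def dualMap {d n : ℕ} [NeZero d] (𝒜 : PointSet d n) : (Fin d → ℤ) →ₗ[ℤ] (Fin n → ℤ) :=
  Matrix.mulVecLin (Matrix.of 𝒜.pt)

/-- The group `D` of degrees, the cokernel of `M → ℤ^n`. -/
abbrev D {d n : ℕ} [NeZero d] (𝒜 : PointSet d n) : Type :=
  (Fin n → ℤ) ⧸ LinearMap.range 𝒜.dualMap

/-- The projection `Φ : ℤ^n → D`. -/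
def Φ {d n : ℕ} [NeZero d] (𝒜 : PointSet d n) : (Fin n → ℤ) →ₗ[ℤ] 𝒜.D :=
  (LinearMap.range 𝒜.dualMap).mkQ

/-- The degree in `D` of the variable `x_i`. -/
def varDegree {d n : ℕ} [NeZero d] (𝒜 : PointSet d n) (i : Fin n) : 𝒜.D :=
  𝒜.Φ (Pi.single i 1)

/-- The `D`-grading of `S = ℂ[x_1, …, x_n]`. -/
noncomputable abbrev gradedPart {d n : ℕ} [NeZero d] (𝒜 : PointSet d n) :
    𝒜.D → Submodule ℂ (MvPolynomial (Fin n) ℂ) :=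
  MvPolynomial.weightedHomogeneousSubmodule ℂ 𝒜.varDegree

instance gradedMonoid {d n : ℕ} [NeZero d] (𝒜 : PointSet d n) :
    SetLike.GradedMonoid 𝒜.gradedPart :=
  MvPolynomial.WeightedHomogeneousSubmodule.gradedMonoid

end PointSet

/-- A phase: a regular triangulation of the point set `𝒜`, given by its maximal simplices
`σ_1, …, σ_m` (as sets of indices of points of `𝒜`). Not every point of `𝒜` has to be a vertex
of some simplex. -/
structure Phase {d n : ℕ} [NeZero d] (𝒜 : PointSet d n) where
  /-- the number of maximal simplices -/
  m : ℕ
  simplex : Fin m → Finset (Fin n)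
  simplex_injective : Function.Injective simplex
  /-- every maximal simplex has dimension `d - 1` -/
  card_simplex : ∀ k, (simplex k).card = d
  independent : ∀ k, AffineIndependent ℝ fun i : {i // i ∈ simplex k} => toReal (𝒜.pt i.1)
  cover : ⋃ k, 𝒜.hull (simplex k) = 𝒜.hull Finset.univ
  face_to_face : ∀ k l, 𝒜.hull (simplex k) ∩ 𝒜.hull (simplex l) =
    𝒜.hull (simplex k ∩ simplex l)
  /-- the triangulation is regular: there are heights `ω_i` for which the simplices are given by
  faces of the lower hull of the lifted points `(a_i, ω_i)` -/
  regular : ∃ ω : Fin n → ℝ, ∀ k, ∃ c : Fin d → ℝ,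
    (∀ i ∈ simplex k, c ⬝ᵥ toReal (𝒜.pt i) = ω i) ∧
    ∀ i ∉ simplex k, c ⬝ᵥ toReal (𝒜.pt i) < ω i

namespace Phase

/-- The generator `∏_{i ∉ σ_k} x_i` of the Cox ideal. -/
noncomputable def coxGenerator {d n : ℕ} [NeZero d] {𝒜 : PointSet d n} (P : Phase 𝒜)
    (k : Fin P.m) : MvPolynomial (Fin n) ℂ :=
  ∏ i ∈ (P.simplex k)ᶜ, MvPolynomial.X i

/-- The Cox ideal `B_Σ`. -/
noncomputable def coxIdeal {d n : ℕ} [NeZero d] {𝒜 : PointSet d n} (P : Phase 𝒜) :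
    Ideal (MvPolynomial (Fin n) ℂ) :=
  Ideal.span (Set.range P.coxGenerator)

/-- The degree in `D` of a generator of the Cox ideal. -/
def coxDegree {d n : ℕ} [NeZero d] {𝒜 : PointSet d n} (P : Phase 𝒜) (k : Fin P.m) : 𝒜.D :=
  ∑ i ∈ (P.simplex k)ᶜ, 𝒜.varDegree i

theorem coxGenerator_mem {d n : ℕ} [NeZero d] {𝒜 : PointSet d n} (P : Phase 𝒜) (k : Fin P.m) :
    P.coxGenerator k ∈ 𝒜.gradedPart (P.coxDegree k) :=
  SetLike.prod_mem_graded 𝒜.gradedPart _ _ fun i _ => MvPolynomial.isWeightedHomogeneous_X ℂ _ i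

/-- `δ ∈ D` is `B_Σ`-acyclic if `H^k_{B_Σ}(S)_δ = 0` for all `k`. -/
def IsAcyclic {d n : ℕ} [NeZero d] {𝒜 : PointSet d n} (P : Phase 𝒜) (δ : 𝒜.D) : Prop :=
  ∀ k : ℕ, localCohomologyPiece 𝒜.gradedPart P.coxGenerator P.coxDegree P.coxGenerator_mem k δ = ⊥

end Phase

/-- Two families of `T` vectors in `D` differ trivially if one arises from the other by a
permutation and a shift by a fixed vector. -/
def trivialSetoid (D : Type) [AddCommGroup D] (T : ℕ) : Setoid (Fin T → D) where
  r α β := ∃ (π : Equiv.Perm (Fin T)) (c : D), ∀ i, β i = α (π i) + c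
  iseqv :=
    { refl := fun α => ⟨1, 0, fun i => by simp⟩
      symm := by
        rintro α β ⟨π, c, h⟩
        exact ⟨π⁻¹, -c, fun i => by simp [h]⟩
      trans := by
        rintro α β γ ⟨π, c, h⟩ ⟨ρ, b, h'⟩
        exact ⟨π * ρ, c + b, fun i => by simp [h, h', add_assoc]⟩ }

end ToricPhase

/-!
The proof extracts Euler characteristics from the Čech complex and studies them with convex
geometry.

The ring `S` is graded by `ℤ^n`, and the part of the Čech complex of multidegree `v` is a direct
summand of its part of degree `Φ(v)`. If `Φ(v)` is acyclic, this finite-dimensional complex is exact,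
so its Euler characteristic vanishes (`sum_isAdmissible_eq_zero`). By Möbius inversion this says that
the subcomplex of the triangulation induced on `I = {i | v i < 0}` has reduced Euler characteristic
zero, unless `I` is empty (`Phase.IsAcyclic.sum_faces`). Only this consequence of acyclicity is used.

Call a real vector `u` Euler-tight if the same holds for `I = {i | u i < ⟨m, a_i⟩}`, for every real
linear functional `m`. If `u` and `-u` are Euler-tight, then `u` is itself the restriction of a linear
functional (`Phase.EulerTight.exists_eq_dotProduct`). Indeed, let `m₀` interpolate `u` on a
maximal simplex `σ` with barycenter `x`. If `m₀ ≤ u` failed somewhere, then every functional `m` with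
`m(x) = m₀(x)` would exceed `u` at some point, and Euler-tightness would be a linear relation between
the indicator functions, on the space of these `m`, of the open convex sets `{m | u < m on τ}`, where
`τ` runs through all faces. Such a relation persists when every indicator function is replaced by the
truth value of nonemptiness (`sum_nonempty_eq_zero`). Here only the set of `σ` is empty, as `x` can be
separated from all other faces; so leaving out `σ` does not change the vanishing alternating sum of
all faces, a contradiction. Applying this to `u` and `-u` gives `u = m₀`.

Finally, suppose that infinitely many `δ` are acyclic together with `-δ`. Lifts of `δ` to `ℤ^n` of
minimal maximum norm go to infinity, and a subsequence of the normalized lifts converges to some `u`.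
It is not the restriction of a linear functional, since otherwise the lifts could be shortened by
integral functionals. Hence `u` or `-u` is not Euler-tight, and for a suitable `m` the lifts can be
translated so that their signs become those of `u - m`, which contradicts the acyclicity of `δ` or
`-δ` (`Phase.eventually_not_isAcyclic`). The statement on families follows, as all differences lie in a
finite set.
-/

namespace ToricPhase

open Finset

/-! ### Localizations at squarefree monomials inside the Laurent polynomials -/

section FineGrading

variable {ι ν D K : Type} [Field K] [AddCommGroup D]

/-- The ring `K[ℤ^ν]` of Laurent polynomials. -/
abbrev Laurent (ν K : Type) [Field K] : Type := AddMonoidAlgebra K (ν → ℤ)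

/-- The map `ℕ^ν → ℤ^ν` on exponents. -/
def expHom (ν : Type) : (ν →₀ ℕ) →+ (ν → ℤ) where
  toFun t i := t i
  map_zero' := by ext; simp
  map_add' _ _ := by ext; simp

@[simp] theorem expHom_apply (t : ν →₀ ℕ) (i : ν) : expHom ν t i = t i := rfl

theorem expHom_injective : Function.Injective (expHom ν) := fun a b h => by
  ext i
  simpa using congrFun h i

/-- The inclusion of the polynomials into the Laurent polynomials. -/
noncomputable def toLaurent : MvPolynomial ν K →ₐ[K] Laurent ν K :=
  AddMonoidAlgebra.mapDomainAlgHom K K (expHom ν)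

theorem toLaurent_injective : Function.Injective (toLaurent : MvPolynomial ν K → Laurent ν K) :=
  AddMonoidAlgebra.mapDomain_injective expHom_injective

theorem toLaurent_monomial (t : ν →₀ ℕ) :
    toLaurent (MvPolynomial.monomial t (1 : K)) = AddMonoidAlgebra.single (expHom ν t) 1 :=
  AddMonoidAlgebra.mapDomain_single

theorem coeff_toLaurent_of_neg (a : MvPolynomial ν K) (v : ν → ℤ) (i : ν) (hi : v i < 0) :
    (toLaurent a).coeff v = 0 := by
  refine Finsupp.mapDomain_of_notMem_range _ _ ?_
  rintro ⟨t, rfl⟩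
  simp only [expHom_apply] at hi
  omega

/-- The squarefree monomials `∏_{i ∈ s k} x_i`. -/
noncomputable abbrev sqfreeMonomial (K : Type) [Field K] (s : ι → Finset ν) (k : ι) :
    MvPolynomial ν K := ∏ i ∈ s k, MvPolynomial.X i

/-- The exponent of the monomial `∏_{k ∈ J} ∏_{i ∈ s k} x_i`. -/
noncomputable def prodExp (s : ι → Finset ν) (J : Finset ι) : ν →₀ ℕ :=
  ∑ k ∈ J, ∑ i ∈ s k, Finsupp.single i 1

theorem prod_sqfreeMonomial (s : ι → Finset ν) (J : Finset ι) :
    ∏ k ∈ J, sqfreeMonomial K s k = MvPolynomial.monomial (prodExp s J) 1 := by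
  simp only [prodExp, MvPolynomial.monomial_sum_one]
  rfl

theorem prodExp_eq_zero {s : ι → Finset ν} {J : Finset ι} {i : ν} (h : ∀ k ∈ J, i ∉ s k) :
    prodExp s J i = 0 := by
  classical
  simp only [prodExp, Finsupp.finsetSum_apply]
  refine sum_eq_zero fun k hk => sum_eq_zero fun j hj => Finsupp.single_eq_of_ne ?_
  rintro rfl
  exact h k hk hj

theorem prodExp_pos {s : ι → Finset ν} {J : Finset ι} {i : ν} {k : ι} (hk : k ∈ J)
    (hi : i ∈ s k) : 0 < prodExp s J i := by
  classical
  simp only [prodExp, Finsupp.finsetSum_apply]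
  refine lt_of_lt_of_le Nat.one_pos ((?_ : 1 ≤ ∑ j ∈ s k, (Finsupp.single j 1 : ν →₀ ℕ) i).trans
    (single_le_sum (f := fun k => ∑ j ∈ s k, (Finsupp.single j 1 : ν →₀ ℕ) i)
      (fun _ _ => Nat.zero_le _) hk))
  simpa using single_le_sum (f := fun j => (Finsupp.single j 1 : ν →₀ ℕ) i)
    (fun _ _ => Nat.zero_le _) hi

theorem isUnit_toLaurent (s : ι → Finset ν) (J : Finset ι) :
    IsUnit ((toLaurent (K := K) : MvPolynomial ν K →ₐ[K] Laurent ν K).toRingHom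
      (∏ k ∈ J, sqfreeMonomial K s k)) := by
  refine IsUnit.of_mul_eq_one (AddMonoidAlgebra.single (-expHom ν (prodExp s J)) 1) ?_
  rw [prod_sqfreeMonomial]
  change toLaurent _ * _ = 1
  rw [toLaurent_monomial, AddMonoidAlgebra.single_mul_single]
  simp [AddMonoidAlgebra.one_def]

/-- The inclusion of a localization at a product of squarefree monomials into the Laurent
polynomials. -/
noncomputable def locToLaurent (s : ι → Finset ν) (J : Finset ι) :
    CechLoc (sqfreeMonomial K s) J →+* Laurent ν K :=
  IsLocalization.Away.lift (∏ k ∈ J, sqfreeMonomial K s k) (isUnit_toLaurent s J)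

theorem locToLaurent_algebraMap (s : ι → Finset ν) (J : Finset ι) (a : MvPolynomial ν K) :
    locToLaurent s J (algebraMap _ _ a) = toLaurent a :=
  IsLocalization.Away.lift_eq _ (isUnit_toLaurent s J) a

theorem locToLaurent_smul (s : ι → Finset ν) (J : Finset ι) (a : MvPolynomial ν K)
    (z : CechLoc (sqfreeMonomial K s) J) :
    locToLaurent s J (a • z) = toLaurent a * locToLaurent s J z := by
  rw [Algebra.smul_def, map_mul, locToLaurent_algebraMap]

theorem locToLaurent_cechRes (s : ι → Finset ν) {J J' : Finset ι} (h : J ⊆ J')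
    (z : CechLoc (sqfreeMonomial K s) J) :
    locToLaurent s J' (cechRes _ h z) = locToLaurent s J z := by
  have : (locToLaurent s J').comp (cechRes (sqfreeMonomial K s) h).toRingHom =
      locToLaurent s J := by
    refine IsLocalization.ringHom_ext (Submonoid.powers (∏ k ∈ J, sqfreeMonomial K s k)) ?_
    refine RingHom.ext fun a => ?_
    simp [locToLaurent_algebraMap]
  exact DFunLike.congr_fun this z

theorem locToLaurent_mk'_mul (s : ι → Finset ν) (J : Finset ι) (a : MvPolynomial ν K) (k : ℕ) :
    locToLaurent s J (IsLocalization.mk' (CechLoc (sqfreeMonomial K s) J) a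
      (⟨(∏ k ∈ J, sqfreeMonomial K s k) ^ k, k, rfl⟩ :
        Submonoid.powers (∏ k ∈ J, sqfreeMonomial K s k))) *
      AddMonoidAlgebra.single (expHom ν (k • prodExp s J)) 1 = toLaurent a := by
  rw [← locToLaurent_algebraMap s J a, ← toLaurent_monomial, ← locToLaurent_algebraMap s J,
    ← map_mul]
  congr 1
  rw [← IsLocalization.mk'_spec (CechLoc (sqfreeMonomial K s) J) a
    (⟨(∏ k ∈ J, sqfreeMonomial K s k) ^ k, k, rfl⟩ :
        Submonoid.powers (∏ k ∈ J, sqfreeMonomial K s k))]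
  congr 2
  simp only [prod_sqfreeMonomial, MvPolynomial.monomial_pow, one_pow]

theorem locToLaurent_injective (s : ι → Finset ν) (J : Finset ι) :
    Function.Injective (locToLaurent (K := K) s J) := by
  rw [injective_iff_map_eq_zero]
  intro z hz
  obtain ⟨a, ⟨_, k, rfl⟩, rfl⟩ :=
    IsLocalization.exists_mk'_eq (Submonoid.powers (∏ k ∈ J, sqfreeMonomial K s k)) z
  have h := locToLaurent_mk'_mul s J a k
  rw [hz, zero_mul] at h
  rw [toLaurent_injective (h.symm.trans (map_zero _).symm), IsLocalization.mk'_zero]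

/-- The Laurent monomial `x^v` lies in the localization indexed by `J`: every variable with a
negative exponent is inverted. -/
def IsAdmissible (s : ι → Finset ν) (v : ν → ℤ) (J : Finset ι) : Prop :=
  ∀ i, v i < 0 → ∃ k ∈ J, i ∈ s k

theorem IsAdmissible.mono {s : ι → Finset ν} {v : ν → ℤ} {J J' : Finset ι} (h : J ⊆ J')
    (hJ : IsAdmissible s v J) : IsAdmissible s v J' := fun i hi =>
  let ⟨k, hk, hik⟩ := hJ i hi
  ⟨k, h hk, hik⟩

theorem coeff_locToLaurent_of_not_isAdmissible {s : ι → Finset ν} {v : ν → ℤ} {J : Finset ι}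
    (hJ : ¬ IsAdmissible s v J) (z : CechLoc (sqfreeMonomial K s) J) :
    (locToLaurent s J z).coeff v = 0 := by
  simp only [IsAdmissible, not_forall, not_exists, not_and] at hJ
  obtain ⟨i, hi, hJ⟩ := hJ
  obtain ⟨a, ⟨_, k, rfl⟩, rfl⟩ :=
    IsLocalization.exists_mk'_eq (Submonoid.powers (∏ k ∈ J, sqfreeMonomial K s k)) z
  have h := congrArg (fun p : Laurent ν K => p.coeff (v + expHom ν (k • prodExp s J)))
    (locToLaurent_mk'_mul s J a k)
  beta_reduce at h
  rw [coeff_toLaurent_of_neg (i := i) _ _ (by simpa [prodExp_eq_zero hJ] using hi),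
    AddMonoidAlgebra.coeff_mul_single_eq_coeff_mul v (by simp), mul_one] at h
  exact h

/-- If `x^v` is admissible for `J`, it is an element of degree `Φ(v)` of the localization indexed
by `J`. -/
theorem exists_monomial [Fintype ν] {s : ι → Finset ν} (w : ν → D)
    [SetLike.GradedMonoid (MvPolynomial.weightedHomogeneousSubmodule K w)] {v : ν → ℤ}
    {J : Finset ι} (hJ : IsAdmissible s v J)
    (hf : ∏ k ∈ J, sqfreeMonomial K s k ∈ MvPolynomial.weightedHomogeneousSubmodule K w
      (∑ k ∈ J, ∑ i ∈ s k, w i)) :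
    ∃ z ∈ awayPiece (MvPolynomial.weightedHomogeneousSubmodule K w) (∏ k ∈ J, sqfreeMonomial K s k)
      (∑ k ∈ J, ∑ i ∈ s k, w i) hf (∑ i, v i • w i),
      locToLaurent s J z = AddMonoidAlgebra.single v 1 := by
  -- A common bound for the orders of the poles of `x^v`.
  let k : ℕ := ∑ i, (v i).natAbs
  let t : ν →₀ ℕ := Finsupp.equivFunOnFinite.symm fun i => (v i + k * prodExp s J i).toNat
  have ht : ∀ i, (t i : ℤ) = v i + k * prodExp s J i := by
    intro i
    refine Int.toNat_of_nonneg ?_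
    rcases le_or_gt 0 (v i) with h | h
    · positivity
    · obtain ⟨l, hl, hi⟩ := hJ i h
      have h1 : (1 : ℤ) ≤ prodExp s J i := by exact_mod_cast prodExp_pos hl hi
      have h2 : ((v i).natAbs : ℤ) ≤ k := by
        exact_mod_cast single_le_sum (f := fun i => (v i).natAbs) (fun _ _ => Nat.zero_le _)
          (mem_univ i)
      nlinarith [abs_nonneg (v i), Int.natCast_natAbs (v i), neg_abs_le (v i)]
  refine ⟨_, ⟨k, MvPolynomial.monomial t 1, ?_, rfl⟩, ?_⟩
  · refine MvPolynomial.isWeightedHomogeneous_monomial _ _ _ ?_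
    have he : Finsupp.weight w (prodExp s J) = ∑ k ∈ J, ∑ i ∈ s k, w i := by
      simp [prodExp, map_sum, Finsupp.weight_single]
    rw [← he, Finsupp.weight_apply, Finsupp.weight_apply, Finsupp.sum_fintype _ _ (by simp),
      Finsupp.sum_fintype _ _ (by simp), smul_sum, ← sum_add_distrib]
    refine sum_congr rfl fun i _ => ?_
    rw [← natCast_zsmul, ht, add_smul, ← natCast_zsmul (prodExp s J i • w i),
      ← natCast_zsmul (w i), mul_smul]
  · have h := locToLaurent_mk'_mul s J (MvPolynomial.monomial t (1 : K)) k
    rw [toLaurent_monomial] at h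
    have hu : IsUnit (AddMonoidAlgebra.single (expHom ν (k • prodExp s J)) (1 : K)) := by
      refine IsUnit.of_mul_eq_one (AddMonoidAlgebra.single (-expHom ν (k • prodExp s J)) 1) ?_
      rw [AddMonoidAlgebra.single_mul_single]
      simp [AddMonoidAlgebra.one_def]
    refine hu.mul_right_cancel (h.trans ?_)
    rw [AddMonoidAlgebra.single_mul_single, one_mul]
    congr 1
    ext i
    simp [ht]

end FineGrading

/-! ### The multigraded parts of the Čech complex -/

section FineComplex

variable {ι ν D K : Type} [Field K] [AddCommGroup D]

/-- The cochains of degree `p` of the part of the Čech complex of multidegree `v`: one copy of `K`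
for every localization that contains the monomial `x^v`. -/
abbrev FineCochain (K : Type) (s : ι → Finset ν) (v : ν → ℤ) (p : ℕ) : Type :=
  {J : Finset ι // J.card = p ∧ IsAdmissible s v J} → K

open Classical in
/-- A fine cochain, extended by zero to all index sets. -/
noncomputable def FineCochain.ext0 {s : ι → Finset ν} {v : ν → ℤ} {p : ℕ}
    (c : FineCochain K s v p) (J : Finset ι) : K :=
  if h : J.card = p ∧ IsAdmissible s v J then c ⟨J, h⟩ else 0

/-- The differential of the part of the Čech complex of multidegree `v`. -/
noncomputable def fineD [LinearOrder ι] (K : Type) [Field K] (s : ι → Finset ν) (v : ν → ℤ) (p : ℕ) :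
    FineCochain K s v p →ₗ[K] FineCochain K s v (p + 1) where
  toFun c J := ∑ i : {i // i ∈ J.1}, (-1) ^ (J.1.filter (· < i.1)).card *
    FineCochain.ext0 c (J.1.erase i.1)
  map_add' a b := by
    ext J
    simp only [Pi.add_apply, ← sum_add_distrib, ← mul_add]
    refine sum_congr rfl fun i _ => ?_
    congr 1
    simp only [FineCochain.ext0]
    split_ifs <;> simp
  map_smul' r a := by
    ext J
    simp only [Pi.smul_apply, smul_eq_mul, mul_sum, RingHom.id_apply]
    refine sum_congr rfl fun i _ => ?_
    rw [mul_left_comm]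
    congr 1
    simp only [FineCochain.ext0]
    split_ifs <;> simp

theorem ext0_fineD [LinearOrder ι] {s : ι → Finset ν} {v : ν → ℤ} {p : ℕ} (c : FineCochain K s v p)
    (J : Finset ι) (hJ : J.card = p + 1) :
    FineCochain.ext0 (fineD K s v p c) J = ∑ i : {i // i ∈ J},
      (-1) ^ (J.filter (· < i.1)).card * FineCochain.ext0 c (J.erase i.1) := by
  by_cases h : IsAdmissible s v J
  · rw [FineCochain.ext0, dif_pos ⟨hJ, h⟩]
    rfl
  · rw [FineCochain.ext0, dif_neg fun h' => h h'.2]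
    refine (sum_eq_zero fun i _ => ?_).symm
    rw [FineCochain.ext0, dif_neg fun h' => h (h'.2.mono (erase_subset _ _)), mul_zero]

/-- The coefficients of `x^v` in a Čech cochain. -/
noncomputable def fineCoeff {s : ι → Finset ν} (v : ν → ℤ) {p : ℕ}
    (z : CechCochain (sqfreeMonomial K s) p) : FineCochain K s v p :=
  fun J => (locToLaurent s J.1 (z ⟨J.1, J.2.1⟩)).coeff v

theorem ext0_fineCoeff {s : ι → Finset ν} (v : ν → ℤ) {p : ℕ}
    (z : CechCochain (sqfreeMonomial K s) p) (J : Finset ι) (hJ : J.card = p) :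
    (fineCoeff v z).ext0 J = (locToLaurent s J (z ⟨J, hJ⟩)).coeff v := by
  by_cases h : IsAdmissible s v J
  · rw [FineCochain.ext0, dif_pos ⟨hJ, h⟩]
    rfl
  · rw [FineCochain.ext0, dif_neg fun h' => h h'.2, coeff_locToLaurent_of_not_isAdmissible h]

theorem locToLaurent_cechD [LinearOrder ι] {s : ι → Finset ν} {p : ℕ} (z : CechCochain (sqfreeMonomial K s) p)
    (J : {J : Finset ι // J.card = p + 1}) :
    locToLaurent s J.1 (cechD _ p z J) = ∑ i : {i // i ∈ J.1},
      (-1) ^ (J.1.filter (· < i.1)).card * locToLaurent s (J.1.erase i.1)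
        (z ⟨J.1.erase i.1, by rw [card_erase_of_mem i.2, J.2, Nat.add_sub_cancel]⟩) := by
  simp only [cechD, LinearMap.pi_apply, LinearMap.sum_apply, LinearMap.smul_apply,
      LinearMap.comp_apply, LinearMap.proj_apply, AlgHom.toLinearMap_apply, map_sum]
  refine sum_congr rfl fun i _ => ?_
  rw [locToLaurent_smul, locToLaurent_cechRes]
  simp

theorem coeff_neg_one_pow_mul (k : ℕ) (a : Laurent ν K) (v : ν → ℤ) :
    ((-1) ^ k * a).coeff v = (-1) ^ k * a.coeff v := by
  rcases neg_one_pow_eq_or (Laurent ν K) k with h | h <;>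
  rcases Nat.even_or_odd k with h' | h' <;> simp [h'.neg_one_pow]

theorem fineCoeff_cechD [LinearOrder ι] {s : ι → Finset ν} (v : ν → ℤ) {p : ℕ}
    (z : CechCochain (sqfreeMonomial K s) p) :
    fineCoeff v (cechD _ p z) = fineD K s v p (fineCoeff v z) := by
  ext J
  change (locToLaurent s J.1 (cechD _ p z ⟨J.1, J.2.1⟩)).coeff v = ∑ i : {i // i ∈ J.1}, _ * _
  rw [locToLaurent_cechD z ⟨J.1, J.2.1⟩]
  simp only [AddMonoidAlgebra.coeff_sum, Finsupp.finsetSum_apply]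
  refine sum_congr rfl fun i _ => ?_
  rw [coeff_neg_one_pow_mul, ext0_fineCoeff]

theorem neg_one_pow_mul_single (k : ℕ) (v : ν → ℤ) (a : K) :
    ((-1) ^ k * AddMonoidAlgebra.single v a : Laurent ν K) =
      AddMonoidAlgebra.single v ((-1) ^ k * a) := by
  rcases Nat.even_or_odd k with h | h <;> simp [h.neg_one_pow]

theorem fineCoeff_of_lift {s : ι → Finset ν} (v : ν → ℤ) {p : ℕ} {c : FineCochain K s v p}
    {z : CechCochain (sqfreeMonomial K s) p}
    (hz : ∀ J : {J : Finset ι // J.card = p}, locToLaurent s J.1 (z J) =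
        (AddMonoidAlgebra.single v (FineCochain.ext0 c J.1) : Laurent ν K)) :
    fineCoeff v z = c := by
  ext J
  simp only [fineCoeff]
  rw [hz ⟨J.1, J.2.1⟩]
  simp [FineCochain.ext0, J.2]

section Lift

variable [Fintype ν] {s : ι → Finset ν} (w : ν → D)
  [SetLike.GradedMonoid (MvPolynomial.weightedHomogeneousSubmodule K w)] (v : ν → ℤ)
  (hf : ∀ k, sqfreeMonomial K s k ∈ MvPolynomial.weightedHomogeneousSubmodule K w
    (∑ i ∈ s k, w i))

/-- A fine cochain `c` gives the homogeneous Čech cochain whose components are the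
`c_J x^v`. -/
theorem exists_lift {p : ℕ} (c : FineCochain K s v p) :
    ∃ z ∈ cechCochainPiece (MvPolynomial.weightedHomogeneousSubmodule K w)
      (sqfreeMonomial K s) (fun k => ∑ i ∈ s k, w i) hf p (∑ i, v i • w i),
      ∀ J : {J : Finset ι // J.card = p}, locToLaurent s J.1 (z J) =
        (AddMonoidAlgebra.single v (FineCochain.ext0 c J.1) : Laurent ν K) := by
  classical
  choose! x hx hx' using fun (J : Finset ι) (hJ : IsAdmissible s v J) =>
    exists_monomial w hJ (SetLike.prod_mem_graded (MvPolynomial.weightedHomogeneousSubmodule K w)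
      (fun k => ∑ i ∈ s k, w i) (sqfreeMonomial K s) fun i _ => hf i)
  refine ⟨fun J => if IsAdmissible s v J.1 then c.ext0 J.1 • x J.1 else 0, ?_, fun J => ?_⟩
  · intro J _
    beta_reduce
    split_ifs with h
    · exact Submodule.smul_mem _ _ (hx _ h)
    · exact Submodule.zero_mem _
  · beta_reduce
    split_ifs with h
    · rw [← algebraMap_smul (MvPolynomial ν K), locToLaurent_smul, hx' _ h, AlgHom.commutes,
        ← Algebra.smul_def, AddMonoidAlgebra.smul_single, smul_eq_mul, mul_one]
    · rw [FineCochain.ext0, dif_neg fun h' => h h'.2, map_zero, AddMonoidAlgebra.single_zero]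

theorem fineD_comp_fineD [LinearOrder ι] (hf : ∀ k, sqfreeMonomial K s k ∈
    MvPolynomial.weightedHomogeneousSubmodule K w (∑ i ∈ s k, w i)) {p : ℕ} (c : FineCochain K s v p) :
    fineD K s v (p + 1) (fineD K s v p c) = 0 := by
  obtain ⟨z, -, hz⟩ := exists_lift w v hf c
  rw [← fineCoeff_of_lift v hz, ← fineCoeff_cechD, ← fineCoeff_cechD, cechD_comp_cechD]
  ext J
  simp [fineCoeff]

/-- If the homogeneous cocycles of degree `Φ(v)` are coboundaries, then the part of the Čech complex
of multidegree `v` is exact, because it is a direct summand. -/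
theorem fine_exact [LinearOrder ι] (p : ℕ)
    (hac : localCohomologyPiece (MvPolynomial.weightedHomogeneousSubmodule K w)
      (sqfreeMonomial K s) (fun k => ∑ i ∈ s k, w i) hf p (∑ i, v i • w i) = ⊥)
    (c : FineCochain K s v p) (hc : fineD K s v p c = 0) :
    ∃ z ∈ cechBoundaries (sqfreeMonomial K s) p, fineCoeff v z = c := by
  obtain ⟨z, hmem, hz⟩ := exists_lift w v hf c
  have hdz : cechD _ p z = 0 := by
    ext J
    refine locToLaurent_injective s J.1 ?_
    rw [locToLaurent_cechD, Pi.zero_apply, map_zero]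
    refine (sum_congr rfl fun i _ => by
      rw [hz ⟨J.1.erase i.1, by rw [card_erase_of_mem i.2, J.2, Nat.add_sub_cancel]⟩,
        neg_one_pow_mul_single]).trans ?_
    refine (map_sum (AddMonoidAlgebra.singleAddHom v) _ _).symm.trans ?_
    rw [← ext0_fineD c J.1 J.2, hc]
    simp [FineCochain.ext0]
  refine ⟨z, ?_, fineCoeff_of_lift v hz⟩
  have h0 : ((cechBoundaries (sqfreeMonomial K s) p).submoduleOf
      (cechCocycles (sqfreeMonomial K s) p)).mkQ ⟨z, hdz⟩ = 0 := by
    have : ((cechBoundaries (sqfreeMonomial K s) p).submoduleOf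
      (cechCocycles (sqfreeMonomial K s) p)).mkQ ⟨z, hdz⟩ ∈
        localCohomologyPiece (MvPolynomial.weightedHomogeneousSubmodule K w)
      (sqfreeMonomial K s) (fun k => ∑ i ∈ s k, w i) hf p (∑ i, v i • w i) :=
      ⟨⟨z, hdz⟩, hmem, rfl⟩
    rw [hac] at this
    exact this
  rw [Submodule.mkQ_apply, Submodule.Quotient.mk_eq_zero] at h0
  exact h0

end Lift

/-- The Euler characteristic of the part of the Čech complex of multidegree `v` vanishes if
the degree `Φ(v)` is acyclic. -/
theorem sum_isAdmissible_eq_zero [LinearOrder ι] [Fintype ι] [Fintype ν] {s : ι → Finset ν} (w : ν → D)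
    [SetLike.GradedMonoid (MvPolynomial.weightedHomogeneousSubmodule K w)] (v : ν → ℤ)
    [DecidablePred (IsAdmissible s v)]
    (hf : ∀ k, sqfreeMonomial K s k ∈ MvPolynomial.weightedHomogeneousSubmodule K w
      (∑ i ∈ s k, w i))
    (hac : ∀ p, localCohomologyPiece (MvPolynomial.weightedHomogeneousSubmodule K w)
      (sqfreeMonomial K s) (fun k => ∑ i ∈ s k, w i) hf p (∑ i, v i • w i) = ⊥) :
    ∑ J : Finset ι, (if IsAdmissible s v J then (-1 : ℤ) ^ J.card else 0) = 0 := by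
  let N := Fintype.card ι
  let r : ℕ → ℕ := fun p => Module.finrank K (LinearMap.ker (fineD K s v p))
  have hr0 : r 0 = 0 := by
    have : LinearMap.ker (fineD K s v 0) = ⊥ := by
      rw [eq_bot_iff]
      intro c hc
      obtain ⟨z, hz, rfl⟩ := fine_exact w v hf 0 (hac 0) c hc
      rw [(show z = 0 from hz)]
      ext J
      simp [fineCoeff]
    simp [r, this]
  have hrange (p) : LinearMap.range (fineD K s v p) = LinearMap.ker (fineD K s v (p + 1)) := by
    ext c
    constructor
    · rintro ⟨c, rfl⟩
      exact fineD_comp_fineD w v hf c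
    · intro hc
      obtain ⟨_, ⟨z, rfl⟩, rfl⟩ := fine_exact w v hf (p + 1) (hac (p + 1)) c hc
      exact ⟨fineCoeff v z, (fineCoeff_cechD v z).symm⟩
  have hdim (p) : Fintype.card {J : Finset ι // J.card = p ∧ IsAdmissible s v J} =
      r (p + 1) + r p := by
    rw [← Module.finrank_fintype_fun_eq_card (R := K),
      ← LinearMap.finrank_range_add_finrank_ker (fineD K s v p), hrange]
  have hrN : r (N + 1) = 0 := by
    have : IsEmpty {J : Finset ι // J.card = N + 1 ∧ IsAdmissible s v J} :=
      ⟨fun J => by have := card_le_univ J.1; have := J.2.1; simp only [N] at *; omega⟩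
    have h1 := hdim (N + 1)
    rw [Fintype.card_eq_zero] at h1
    omega
  have htel (q : ℕ) : ∑ p ∈ range (q + 1), (-1 : ℤ) ^ p * (r (p + 1) + r p : ℕ) =
      (-1) ^ q * r (q + 1) := by
    induction q with
    | zero => simp [hr0]
    | succ q ih =>
      rw [sum_range_succ, ih]
      push_cast
      ring
  have h := htel N
  rw [hrN, Nat.cast_zero, mul_zero] at h
  refine Eq.trans ?_ h
  rw [← sum_fiberwise_of_maps_to (s := univ) (t := range (N + 1)) (g := Finset.card)
    (fun J _ => by have := card_le_univ J; simp only [N, mem_range]; omega)]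
  refine sum_congr rfl fun p _ => ?_
  rw [← hdim, Fintype.card_subtype, ← sum_filter, filter_filter, sum_congr rfl
    (g := fun _ => (-1 : ℤ) ^ p) (fun J hJ => by rw [(mem_filter.1 hJ).2.1])]
  simp [mul_comm]

end FineComplex

/-! ### Acyclic degrees and Euler characteristics of induced subcomplexes -/

section Faces

variable {ι ν : Type} [Fintype ι] [DecidableEq ν] [Fintype ν]

/-- The faces of the simplicial complex with the given maximal simplices, the empty face
included. -/
def faces (σ : ι → Finset ν) : Finset (Finset ν) := univ.filter fun τ => ∃ k, τ ⊆ σ k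

theorem mem_faces {σ : ι → Finset ν} {τ : Finset ν} : τ ∈ faces σ ↔ ∃ k, τ ⊆ σ k := by
  simp [faces]

/-- The alternating sum over the index sets `J` with `I ∩ ⋂_{k ∈ J} σ k = ∅`, expressed
through the Euler characteristic of the subcomplex induced on `I`. -/
theorem sum_index_sets_eq [DecidableEq ι] (σ : ι → Finset ν) (I : Finset ν) :
    ∑ J : Finset ι, (if ∀ i ∈ I, ∃ k ∈ J, i ∉ σ k then (-1 : ℤ) ^ J.card else 0) =
      (if I = ∅ then 1 else 0) - ∑ τ ∈ faces σ, if τ ⊆ I then (-1 : ℤ) ^ τ.card else 0 := by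
  have h1 (J : Finset ι) : (if ∀ i ∈ I, ∃ k ∈ J, i ∉ σ k then (-1 : ℤ) ^ J.card else 0) =
      ∑ τ ∈ I.powerset, (-1 : ℤ) ^ τ.card *
        (if J ⊆ univ.filter (fun k => τ ⊆ σ k) then (-1 : ℤ) ^ J.card else 0) := by
    have h := sum_powerset_neg_one_pow_card (x := I.filter fun i => ∀ k ∈ J, i ∈ σ k)
    have he : (I.filter (fun i => ∀ k ∈ J, i ∈ σ k) = ∅) ↔ ∀ i ∈ I, ∃ k ∈ J, i ∉ σ k := by
      simp [filter_eq_empty_iff]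
    have hp : (I.filter fun i => ∀ k ∈ J, i ∈ σ k).powerset =
        I.powerset.filter fun τ => J ⊆ univ.filter (fun k => τ ⊆ σ k) := by
      ext τ
      simp only [mem_powerset, mem_filter, subset_iff, mem_univ, true_and]
      grind
    rw [hp, sum_filter] at h
    simp only [he] at h
    have h' := congrArg (· * (-1 : ℤ) ^ J.card) h
    simp only [ite_mul, one_mul, zero_mul, sum_mul] at h'
    rw [← h']
    refine sum_congr rfl fun τ _ => ?_
    split_ifs <;> simp
  have h2 (τ : Finset ν) : ∑ J : Finset ι,
      (if J ⊆ univ.filter (fun k => τ ⊆ σ k) then (-1 : ℤ) ^ J.card else 0) =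
        if τ ∈ faces σ then 0 else 1 := by
    have h := sum_powerset_neg_one_pow_card (x := univ.filter fun k => τ ⊆ σ k)
    have hp : (univ.filter fun k => τ ⊆ σ k).powerset =
        univ.filter fun J => J ⊆ univ.filter (fun k => τ ⊆ σ k) := by
      ext J
      simp
    rw [hp, sum_filter] at h
    rw [h]
    simp only [filter_eq_empty_iff, mem_faces, mem_univ, true_implies]
    split_ifs with h1 h2 <;> simp_all
  simp only [h1]
  rw [sum_comm]
  simp only [← mul_sum, h2]
  rw [← sum_powerset_neg_one_pow_card, ← sum_filter, eq_sub_iff_add_eq]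
  have h3 : (faces σ).filter (fun τ => τ ⊆ I) = I.powerset.filter (· ∈ faces σ) := by
    ext τ
    simp [and_comm]
  rw [h3, sum_filter, ← sum_add_distrib]
  refine sum_congr rfl fun τ _ => ?_
  split_ifs <;> simp

end Faces

/-- Let `I` be the set of negative coordinates of a lift of an acyclic degree. If `I ≠ ∅`, then the
subcomplex of the phase induced on `I` has reduced Euler characteristic zero. For `I = ∅` the only
face is the empty one, and the sum is `1`. -/
theorem Phase.IsAcyclic.sum_faces {d n : ℕ} [NeZero d] {𝒜 : PointSet d n} {P : Phase 𝒜}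
    {v : Fin n → ℤ} (h : P.IsAcyclic (𝒜.Φ v)) :
    ∑ τ ∈ faces P.simplex, (if τ ⊆ univ.filter (fun i => v i < 0) then (-1 : ℤ) ^ τ.card else 0) =
      if univ.filter (fun i => v i < 0) = ∅ then 1 else 0 := by
  classical
  have hv : 𝒜.Φ v = ∑ i, v i • 𝒜.varDegree i := by
    conv_lhs => rw [← univ_sum_single v]
    rw [map_sum]
    refine sum_congr rfl fun i _ => ?_
    rw [PointSet.varDegree, ← map_smul, ← Pi.single_smul, smul_eq_mul, mul_one]
  have h0 := sum_isAdmissible_eq_zero (K := ℂ) (s := fun k => (P.simplex k)ᶜ) 𝒜.varDegree v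
    P.coxGenerator_mem (fun p => by rw [← hv]; exact h p)
  have h1 := sum_index_sets_eq P.simplex (univ.filter fun i => v i < 0)
  have h2 : ∀ J, IsAdmissible (fun k => (P.simplex k)ᶜ) v J ↔
      ∀ i ∈ univ.filter (fun i => v i < 0), ∃ k ∈ J, i ∉ P.simplex k := by
    simp [IsAdmissible]
  simp only [h2] at h0
  refine (sub_eq_zero.1 (h1.symm.trans ?_)).symm
  convert h0

/-! ### The Euler characteristic on indicator functions of open convex sets -/

section EulerIntegral

open Classical in
theorem sum_nonempty_eq_zero_of_bounded {α : Type} (s : Finset α) (c : α → ℤ) (A : α → Set ℝ)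
    (ho : ∀ i, IsOpen (A i)) (hc : ∀ i, (A i).OrdConnected) (hb : ∀ i, BddAbove (A i))
    (h : ∀ t, ∑ i ∈ s, (if t ∈ A i then c i else 0) = 0) :
    ∑ i ∈ s, (if (A i).Nonempty then c i else 0) = 0 := by
  -- The terms are grouped by right endpoints: passing from points just left of `b` to `b` itself,
  -- exactly the intervals with right endpoint `b` are left.
  have key (b : ℝ) :
      ∑ i ∈ s, (if (A i).Nonempty ∧ sSup (A i) = b then c i else 0) = 0 := by
    have hev (i : α) : ∀ᶠ t in nhdsWithin b (Set.Iio b),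
        (t ∈ A i ↔ b ∈ A i ∨ ((A i).Nonempty ∧ sSup (A i) = b)) := by
      rcases (A i).eq_empty_or_nonempty with he | hne
      · simp [he]
      by_cases hbA : b ∈ A i
      · filter_upwards [mem_nhdsWithin_of_mem_nhds ((ho i).mem_nhds hbA)] with t ht
        simp [ht, hbA]
      rcases lt_trichotomy (sSup (A i)) b with hlt | heq | hgt
      · filter_upwards [mem_nhdsWithin_of_mem_nhds (Ioi_mem_nhds hlt)] with t ht
        have : t ∉ A i := fun h => (Set.mem_Ioi.1 ht).not_ge (le_csSup (hb i) h)
        simp [this, hbA, hlt.ne]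
      · obtain ⟨p, hp⟩ := hne
        have hpb : p < b := lt_of_le_of_ne (heq ▸ le_csSup (hb i) hp) fun h => hbA (h ▸ hp)
        filter_upwards [mem_nhdsWithin_of_mem_nhds (Ioi_mem_nhds hpb), self_mem_nhdsWithin]
          with t ht htb
        obtain ⟨q, hq, htq⟩ := exists_lt_of_lt_csSup ⟨p, hp⟩
          (show t < sSup (A i) by rw [heq]; exact htb)
        have : t ∈ A i := (hc i).out hp hq ⟨(Set.mem_Ioi.1 ht).le, htq.le⟩
        simp only [this, heq, and_true, true_iff]
        exact Or.inr ⟨p, hp⟩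
      · obtain ⟨q, hq, hbq⟩ := exists_lt_of_lt_csSup hne hgt
        filter_upwards [self_mem_nhdsWithin] with t ht
        have : t ∉ A i := fun h => hbA ((hc i).out h hq ⟨(Set.mem_Iio.1 ht).le, hbq.le⟩)
        simp [this, hbA, hgt.ne']
    obtain ⟨t, ht⟩ := ((Filter.eventually_all_finset s).2 fun i _ => hev i).exists
    have h1 := h t
    have h2 := sub_eq_zero.2 (h1.trans (h b).symm)
    rw [← sum_sub_distrib] at h2
    refine Eq.trans ?_ h2
    refine sum_congr rfl fun i hi => ?_
    have hex : b ∈ A i → sSup (A i) ≠ b := by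
      intro hbA heq
      obtain ⟨e, he, hsub⟩ := Metric.isOpen_iff.1 (ho i) b hbA
      have : b + e / 2 ∈ A i := hsub (by simp [abs_of_pos he, he])
      have := le_csSup (hb i) this
      linarith
    have hti := ht i hi
    by_cases hbA : b ∈ A i
    · have := hex hbA
      simp_all
    · simp only [hti, hbA, false_or, if_false, sub_zero]
  have hf := sum_fiberwise_of_maps_to (s := s) (t := s.image fun i => sSup (A i))
    (g := fun i => sSup (A i)) (fun i hi => mem_image_of_mem _ hi)
    (fun i => if (A i).Nonempty then c i else 0)
  rw [← hf]
  refine sum_eq_zero fun b _ => ?_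
  rw [sum_filter]
  refine Eq.trans ?_ (key b)
  refine sum_congr rfl fun i _ => ?_
  by_cases h1 : (A i).Nonempty <;> simp [h1]

open Classical in
theorem sum_nonempty_eq_zero_real {α : Type} (s : Finset α) (c : α → ℤ) (A : α → Set ℝ)
    (ho : ∀ i, IsOpen (A i)) (hc : ∀ i, (A i).OrdConnected)
    (h : ∀ t, ∑ i ∈ s, (if t ∈ A i then c i else 0) = 0) :
    ∑ i ∈ s, (if (A i).Nonempty then c i else 0) = 0 := by
  -- A common upper bound `R` for one point of each nonempty interval reduces to the bounded case.
  choose! p hp using fun i (hi : (A i).Nonempty) => hi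
  obtain ⟨R, hR⟩ := (s.image p).exists_le
  have hcut := sum_nonempty_eq_zero_of_bounded s c (fun i => A i ∩ Set.Iio (R + 1))
    (fun i => (ho i).inter isOpen_Iio) (fun i => (hc i).inter Set.ordConnected_Iio)
    (fun i => ⟨R + 1, fun t ht => ht.2.le⟩) (fun t => by
      by_cases ht : t < R + 1
      · simpa [ht] using h t
      · simp [ht])
  refine Eq.trans ?_ hcut
  refine sum_congr rfl fun i hi => if_congr ⟨fun hne => ⟨p i, hp i hne, ?_⟩, fun hne => hne.left⟩
    rfl rfl
  have := hR (p i) (mem_image_of_mem p hi)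
  simp only [Set.mem_Iio]
  linarith

open Classical in
/-- A linear relation between the indicator functions of open convex sets remains true if each
indicator function is replaced by `1` or `0` according to whether the set is nonempty. In other
words, the Euler characteristic is a well-defined linear functional on these functions. -/
theorem sum_nonempty_eq_zero {α : Type} (s : Finset α) (c : α → ℤ) {k : ℕ}
    (C : α → Set (Fin k → ℝ)) (ho : ∀ i, IsOpen (C i)) (hc : ∀ i, Convex ℝ (C i))
    (h : ∀ x, ∑ i ∈ s, (if x ∈ C i then c i else 0) = 0) :
    ∑ i ∈ s, (if (C i).Nonempty then c i else 0) = 0 := by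
  induction k with
  | zero =>
    refine Eq.trans ?_ (h default)
    exact sum_congr rfl fun i _ => if_congr
      ⟨fun ⟨x, hx⟩ => Subsingleton.elim x default ▸ hx, fun hx => ⟨_, hx⟩⟩ rfl rfl
  | succ k ih =>
    let A : α → Set ℝ := fun i => (fun x : Fin (k + 1) → ℝ => x 0) '' C i
    have hA (i t) : t ∈ A i ↔ ((fun x : Fin k → ℝ => Fin.cons t x) ⁻¹' C i :
        Set (Fin k → ℝ)).Nonempty := by
      constructor
      · rintro ⟨x, hx, rfl⟩
        exact ⟨Fin.tail x, by simpa using hx⟩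
      · rintro ⟨x, hx⟩
        exact ⟨_, hx, by simp⟩
    have h1 := sum_nonempty_eq_zero_real s c A
      (fun i => isOpenMap_eval (0 : Fin (k + 1)) _ (ho i))
      (fun i => ((hc i).is_linear_image (IsLinearMap.mk (fun _ _ => rfl)
        (fun _ _ => rfl))).ordConnected)
      (fun t => by
        simp only [hA]
        refine ih _ (fun i => (ho i).preimage (by fun_prop)) (fun i => ?_) fun x => h (Fin.cons t x)
        intro x hx y hy a b ha hb hab
        have := hc i hx hy ha hb hab
        simp only [Set.mem_preimage]
        convert this using 1
        ext j
        refine Fin.cases ?_ (fun j => ?_) j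
        · simp [← add_mul, hab]
        · simp)
    simpa [A] using h1

end EulerIntegral

/-! ### Functions on the point set whose induced subcomplexes are acyclic -/

section Geometry

theorem dotProductEquiv_symm_dotProduct {d : ℕ} (f : (Fin d → ℝ) →ₗ[ℝ] ℝ) (y : Fin d → ℝ) :
    (dotProductEquiv ℝ (Fin d)).symm f ⬝ᵥ y = f y :=
  LinearMap.congr_fun ((dotProductEquiv ℝ (Fin d)).apply_symm_apply f) y

variable {d n : ℕ} [NeZero d] {𝒜 : PointSet d n}

theorem toReal_pt_zero (𝒜 : PointSet d n) (i : Fin n) : toReal (𝒜.pt i) 0 = 1 := by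
  simp [toReal, 𝒜.height_one i]

namespace Phase

variable (P : Phase 𝒜) (k : Fin P.m)

/-- The vertices of a maximal simplex are linearly independent, because they lie at height one. -/
theorem linearIndependent_simplex :
    LinearIndependent ℝ fun i : {i // i ∈ P.simplex k} => toReal (𝒜.pt i.1) := by
  rw [linearIndependent_iff']
  intro s g hg i hi
  refine affineIndependent_iff.1 (P.independent k) s g ?_ hg i hi
  simpa [toReal_pt_zero] using congrFun hg 0

theorem simplex_nonempty : (P.simplex k).Nonempty := by
  rw [← card_pos, P.card_simplex]
  exact Nat.pos_of_ne_zero (NeZero.ne d)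

instance : Nonempty {i // i ∈ P.simplex k} := (P.simplex_nonempty k).to_subtype

/-- The basis of `N ⊗ ℝ` formed by the vertices of a maximal simplex. -/
noncomputable def simplexBasis : Module.Basis {i // i ∈ P.simplex k} ℝ (Fin d → ℝ) :=
  basisOfLinearIndependentOfCardEqFinrank (P.linearIndependent_simplex k)
    (by simp [P.card_simplex])

theorem simplexBasis_apply (i : {i // i ∈ P.simplex k}) :
    P.simplexBasis k i = toReal (𝒜.pt i.1) := by
  simp [simplexBasis]

/-- A linear functional can be prescribed on the vertices of a maximal simplex. -/
theorem exists_dotProduct_eq (u : Fin n → ℝ) :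
    ∃ m : Fin d → ℝ, ∀ i ∈ P.simplex k, m ⬝ᵥ toReal (𝒜.pt i) = u i := by
  refine ⟨(dotProductEquiv ℝ (Fin d)).symm ((P.simplexBasis k).constr ℝ fun i => u i.1),
    fun i hi => ?_⟩
  rw [dotProductEquiv_symm_dotProduct, ← P.simplexBasis_apply k ⟨i, hi⟩, Module.Basis.constr_basis]

/-- A linear functional is determined by its values on the vertices of a maximal simplex. -/
theorem eq_zero_of_dotProduct_eq_zero {m : Fin d → ℝ}
    (hm : ∀ i ∈ P.simplex k, m ⬝ᵥ toReal (𝒜.pt i) = 0) : m = 0 := by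
  refine (dotProductEquiv ℝ (Fin d)).injective ((P.simplexBasis k).ext fun i => ?_)
  simpa [simplexBasis_apply] using hm i.1 i.2

/-- The barycenter of a maximal simplex. -/
noncomputable def barycenter : Fin d → ℝ := (d : ℝ)⁻¹ • ∑ i ∈ P.simplex k, toReal (𝒜.pt i)

theorem sum_dotProduct_sub_barycenter (m : Fin d → ℝ) :
    ∑ i ∈ P.simplex k, (m ⬝ᵥ toReal (𝒜.pt i) - m ⬝ᵥ P.barycenter k) = 0 := by
  have hd : (d : ℝ) ≠ 0 := Nat.cast_ne_zero.2 (NeZero.ne d)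
  rw [sum_sub_distrib, sum_const, P.card_simplex, barycenter, dotProduct_smul, dotProduct_sum,
    nsmul_eq_mul, smul_eq_mul, mul_inv_cancel_left₀ hd, sub_self]

theorem barycenter_notMem_hull {ρ : Finset (Fin n)} (hρ : ρ ⊂ P.simplex k) :
    P.barycenter k ∉ 𝒜.hull ρ := by
  intro hx
  obtain ⟨j, hj, hjρ⟩ := exists_of_ssubset hρ
  obtain ⟨m, hm⟩ := P.exists_dotProduct_eq k (Pi.single j 1)
  have hsub : 𝒜.hull ρ ⊆ {y | m ⬝ᵥ y = 0} := by
    refine convexHull_min ?_ ?_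
    · rintro _ ⟨i, hi, rfl⟩
      have hi : i ∈ ρ := hi
      have : i ≠ j := fun h => hjρ (h ▸ hi)
      simpa [this] using hm i (hρ.1 hi)
    · intro y hy z hz a b _ _ _
      simp_all [dotProduct_add, dotProduct_smul]
  have h0 : m ⬝ᵥ P.barycenter k = 0 := hsub hx
  have h1 := P.sum_dotProduct_sub_barycenter k m
  rw [h0, sum_congr rfl (fun i hi => by rw [hm i hi, sub_zero]), sum_eq_single_of_mem j hj fun i _ hij =>
    Pi.single_eq_of_ne hij 1, Pi.single_eq_same] at h1
  exact one_ne_zero h1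

theorem barycenter_notMem_hull_face {τ : Finset (Fin n)} (hτ : τ ∈ faces P.simplex)
    (hne : τ ≠ P.simplex k) : P.barycenter k ∉ 𝒜.hull τ := by
  obtain ⟨l, hl⟩ := mem_faces.1 hτ
  by_cases hlk : l = k
  · subst hlk
    exact P.barycenter_notMem_hull l (lt_of_le_of_ne hl hne)
  · intro hx
    have hd : (d : ℝ) ≠ 0 := Nat.cast_ne_zero.2 (NeZero.ne d)
    have hxk : P.barycenter k ∈ 𝒜.hull (P.simplex k) := by
      rw [barycenter, smul_sum]
      refine (convex_convexHull ℝ _).sum_mem (fun _ _ => by positivity) ?_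
        fun i hi => subset_convexHull ℝ _ ⟨i, hi, rfl⟩
      simp [P.card_simplex, hd]
    have hxl : P.barycenter k ∈ 𝒜.hull (P.simplex l) :=
      convexHull_mono (Set.image_mono (coe_subset.2 hl)) hx
    have hxi : P.barycenter k ∈ 𝒜.hull (P.simplex k ∩ P.simplex l) :=
      P.face_to_face k l ▸ ⟨hxk, hxl⟩
    refine P.barycenter_notMem_hull k (lt_of_le_of_ne inter_subset_left fun h => ?_) hxi
    refine hlk (P.simplex_injective ?_)
    exact (eq_of_subset_of_card_le (inter_eq_left.1 h)
      (by rw [P.card_simplex, P.card_simplex])).symm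

/-- A face other than the maximal simplex `k` can be separated from the barycenter of that
simplex. -/
theorem exists_dotProduct_barycenter_lt {τ : Finset (Fin n)} (hτ : τ ∈ faces P.simplex)
    (hne : τ ≠ P.simplex k) :
    ∃ m : Fin d → ℝ, ∀ i ∈ τ, 0 < m ⬝ᵥ toReal (𝒜.pt i) - m ⬝ᵥ P.barycenter k := by
  have hclosed : IsClosed (𝒜.hull τ) :=
    ((τ.finite_toSet.image _).isCompact_convexHull (𝕜 := ℝ)).isClosed
  obtain ⟨f, r, hfx, hf⟩ := geometric_hahn_banach_point_closed (convex_convexHull ℝ _) hclosed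
    (P.barycenter_notMem_hull_face k hτ hne)
  refine ⟨(dotProductEquiv ℝ (Fin d)).symm f.toLinearMap, fun i hi => ?_⟩
  have := hf _ (subset_convexHull ℝ _ ⟨i, hi, rfl⟩)
  rw [dotProductEquiv_symm_dotProduct, dotProductEquiv_symm_dotProduct]
  exact sub_pos.2 (hfx.trans this)

/-- For every linear functional, the subcomplex induced on the points where `u` lies strictly below it
has reduced Euler characteristic zero, unless there are no such points. -/
def EulerTight (u : Fin n → ℝ) : Prop :=
  ∀ m : Fin d → ℝ, ∑ τ ∈ faces P.simplex,
    (if τ ⊆ univ.filter (fun i => u i < m ⬝ᵥ toReal (𝒜.pt i)) then (-1 : ℤ) ^ τ.card else 0) =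
      if univ.filter (fun i => u i < m ⬝ᵥ toReal (𝒜.pt i)) = ∅ then 1 else 0

variable {P}

theorem EulerTight.sum_faces {u : Fin n → ℝ} (hu : P.EulerTight u) [Nonempty (Fin n)] :
    ∑ τ ∈ faces P.simplex, (-1 : ℤ) ^ τ.card = 0 := by
  obtain ⟨R, hR⟩ := (univ.image u).exists_le
  have h := hu (Pi.single 0 (R + 1))
  have hI : univ.filter (fun i => u i < (Pi.single 0 (R + 1) : Fin d → ℝ) ⬝ᵥ toReal (𝒜.pt i)) =
      univ := by
    refine filter_true_of_mem fun i _ => ?_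
    have := hR (u i) (mem_image_of_mem u (mem_univ i))
    rw [single_dotProduct, toReal_pt_zero]
    linarith
  rw [hI, if_neg univ_nonempty.ne_empty] at h
  simpa using h

/-- For an Euler-tight `u` the linear extension of `u` from each maximal simplex lies below `u`.
Otherwise every functional with the same value as this extension at the barycenter exceeds `u`
at some point, and integrating the Euler characteristic over these functionals shows that the
maximal simplex does not contribute to the vanishing Euler characteristic of the complex. -/
theorem EulerTight.dotProduct_le {u : Fin n → ℝ} (hu : P.EulerTight u) {m₀ : Fin d → ℝ}
    (hm₀ : ∀ i ∈ P.simplex k, m₀ ⬝ᵥ toReal (𝒜.pt i) = u i) (j : Fin n) :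
    m₀ ⬝ᵥ toReal (𝒜.pt j) ≤ u j := by
  classical
  by_contra! hj
  set x := P.barycenter k
  have : Nonempty (Fin n) := ⟨j⟩
  -- The functionals that agree with `m₀` at the barycenter, parametrized by all functionals.
  let shift : (Fin d → ℝ) → (Fin d → ℝ) := fun m => m₀ + (m - Pi.single 0 (m ⬝ᵥ x))
  have hshift (m) (i) : shift m ⬝ᵥ toReal (𝒜.pt i) =
      m₀ ⬝ᵥ toReal (𝒜.pt i) + (m ⬝ᵥ toReal (𝒜.pt i) - m ⬝ᵥ x) := by
    simp [shift, add_dotProduct, sub_dotProduct, toReal_pt_zero]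
  let C : Finset (Fin n) → Set (Fin d → ℝ) :=
    fun τ => {m | ∀ i ∈ τ, u i < shift m ⬝ᵥ toReal (𝒜.pt i)}
  have hC (τ) : C τ = ⋂ i ∈ τ, {m | u i < shift m ⬝ᵥ toReal (𝒜.pt i)} := by
    ext
    simp [C]
  have hopen (τ) : IsOpen (C τ) := by
    rw [hC]
    refine isOpen_biInter_finset fun i _ => isOpen_lt continuous_const ?_
    rw [funext fun m => hshift m i]
    simp only [dotProduct]
    fun_prop
  have hconv (τ) : Convex ℝ (C τ) := by
    intro a ha b hb s t hs ht hst i hi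
    have h1 := ha i hi
    have h2 := hb i hi
    rw [hshift] at h1 h2 ⊢
    simp only [add_dotProduct, smul_dotProduct, smul_eq_mul]
    obtain rfl : t = 1 - s := by linarith
    rcases hs.eq_or_lt with rfl | hs
    · linarith
    · nlinarith [mul_lt_mul_of_pos_left h1 hs, mul_le_mul_of_nonneg_left h2.le ht]
  have hne (m) : univ.filter (fun i => u i < shift m ⬝ᵥ toReal (𝒜.pt i)) ≠ ∅ := by
    intro h
    simp only [filter_eq_empty_iff, mem_univ, true_implies, not_lt, hshift] at h
    have hle : ∀ i ∈ P.simplex k, m ⬝ᵥ toReal (𝒜.pt i) - m ⬝ᵥ x ≤ 0 := fun i hi => by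
      have := h (x := i)
      rw [hm₀ i hi] at this
      linarith
    have heq := (sum_eq_zero_iff_of_nonpos hle).1 (P.sum_dotProduct_sub_barycenter k m)
    have hz := P.eq_zero_of_dotProduct_eq_zero k (m := m - Pi.single 0 (m ⬝ᵥ x)) fun i hi => by
      simpa [sub_dotProduct, toReal_pt_zero] using heq i hi
    have h0 := congrArg (· ⬝ᵥ toReal (𝒜.pt j)) hz
    simp only [sub_dotProduct, single_dotProduct, toReal_pt_zero, zero_dotProduct, mul_one] at h0
    have := h (x := j)
    linarith
  have hrel := sum_nonempty_eq_zero (faces P.simplex) (fun τ => (-1 : ℤ) ^ τ.card) C hopen hconv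
    (fun m => by
      have h := hu (shift m)
      rw [if_neg (hne m)] at h
      refine Eq.trans ?_ h
      refine sum_congr rfl fun τ _ => ?_
      have : m ∈ C τ ↔ τ ⊆ univ.filter (fun i => u i < shift m ⬝ᵥ toReal (𝒜.pt i)) := by
        simp [C, subset_iff]
      simp only [this])
  have hCk : ¬ (C (P.simplex k)).Nonempty := by
    rintro ⟨m, hm⟩
    have hpos : ∀ i ∈ P.simplex k, 0 < m ⬝ᵥ toReal (𝒜.pt i) - m ⬝ᵥ x := fun i hi => by
      have := hm i hi
      rw [hshift, hm₀ i hi] at this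
      linarith
    exact (sum_pos hpos (P.simplex_nonempty k)).ne' (P.sum_dotProduct_sub_barycenter k m)
  have hCne : ∀ τ ∈ faces P.simplex, τ ≠ P.simplex k → (C τ).Nonempty := by
    intro τ hτ hτk
    obtain ⟨m, hm⟩ := P.exists_dotProduct_barycenter_lt k hτ hτk
    have hev : ∀ i ∈ τ, ∀ᶠ t : ℝ in Filter.atTop,
        u i - m₀ ⬝ᵥ toReal (𝒜.pt i) < t * (m ⬝ᵥ toReal (𝒜.pt i) - m ⬝ᵥ x) := fun i hi =>
      (Filter.tendsto_id.atTop_mul_const (hm i hi)).eventually_gt_atTop _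
    obtain ⟨t, ht⟩ := ((Filter.eventually_all_finset τ).2 hev).exists
    refine ⟨t • m, fun i hi => ?_⟩
    have := ht i hi
    rw [hshift, smul_dotProduct, smul_dotProduct, smul_eq_mul, smul_eq_mul]
    linarith
  have hk : P.simplex k ∈ faces P.simplex := mem_faces.2 ⟨k, Subset.rfl⟩
  have htot := hu.sum_faces
  rw [← add_sum_erase _ _ hk] at htot hrel
  rw [if_neg hCk, zero_add, sum_congr rfl fun τ hτ => if_pos (hCne τ (mem_of_mem_erase hτ)
    (ne_of_mem_erase hτ))] at hrel
  rw [hrel, add_zero] at htot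
  exact pow_ne_zero _ (by norm_num) htot

theorem nonempty_simplices (P : Phase 𝒜) [Nonempty (Fin n)] : Nonempty (Fin P.m) := by
  obtain ⟨i⟩ := ‹Nonempty (Fin n)›
  have : toReal (𝒜.pt i) ∈ ⋃ k, 𝒜.hull (P.simplex k) := by
    rw [P.cover]
    exact subset_convexHull ℝ _ ⟨i, by simp, rfl⟩
  obtain ⟨k, -⟩ := Set.mem_iUnion.1 this
  exact ⟨k⟩

/-- If `u` and `-u` are Euler-tight, then `u` is the restriction of a linear functional. -/
theorem EulerTight.exists_eq_dotProduct {u : Fin n → ℝ} (hu : P.EulerTight u)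
    (hu' : P.EulerTight (-u)) : ∃ m : Fin d → ℝ, ∀ i, m ⬝ᵥ toReal (𝒜.pt i) = u i := by
  rcases isEmpty_or_nonempty (Fin n) with h | h
  · exact ⟨0, fun i => h.elim i⟩
  obtain ⟨k⟩ := P.nonempty_simplices
  obtain ⟨m, hm⟩ := P.exists_dotProduct_eq k u
  refine ⟨m, fun i => le_antisymm (hu.dotProduct_le k hm i) ?_⟩
  have := hu'.dotProduct_le k (m₀ := -m) (fun i hi => by rw [neg_dotProduct, hm i hi]; rfl) i
  rw [neg_dotProduct] at this
  exact neg_le_neg_iff.1 this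

end Phase

end Geometry

/-! ### Degrees going to infinity -/

section Asymptotics

variable {d n : ℕ} [NeZero d] {𝒜 : PointSet d n} {P : Phase 𝒜}

open Filter Topology

theorem Φ_sub_dualMap (v : Fin n → ℤ) (q : Fin d → ℤ) : 𝒜.Φ (v - 𝒜.dualMap q) = 𝒜.Φ v := by
  rw [map_sub, sub_eq_self]
  exact (Submodule.Quotient.mk_eq_zero _).2 ⟨q, rfl⟩

/-- Real linear functionals are approximated by integral ones up to a bounded error on `𝒜`. -/
theorem exists_dualMap_near (𝒜 : PointSet d n) : ∃ B : ℝ, ∀ m : Fin d → ℝ, ∃ q : Fin d → ℤ, ∀ i,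
    |m ⬝ᵥ toReal (𝒜.pt i) - (𝒜.dualMap q i : ℝ)| ≤ B := by
  refine ⟨∑ i, ∑ j, |(𝒜.pt i j : ℝ)|, fun m => ⟨fun j => round (m j), fun i => ?_⟩⟩
  have h : m ⬝ᵥ toReal (𝒜.pt i) - (𝒜.dualMap (fun j => round (m j)) i : ℝ) =
      ∑ j, (m j - round (m j)) * 𝒜.pt i j := by
    simp only [PointSet.dualMap, Matrix.mulVecLin_apply, Matrix.mulVec, dotProduct,
      Matrix.of_apply, toReal, Int.cast_sum, Int.cast_mul, ← sum_sub_distrib]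
    exact sum_congr rfl fun j _ => by ring
  rw [h]
  calc |∑ j, (m j - round (m j)) * (𝒜.pt i j : ℝ)|
      ≤ ∑ j, |(m j - round (m j)) * (𝒜.pt i j : ℝ)| := abs_sum_le_sum_abs _ _
    _ ≤ ∑ j, |(𝒜.pt i j : ℝ)| := sum_le_sum fun j _ => by
        rw [abs_mul]
        have := abs_sub_round (m j)
        nlinarith [abs_nonneg (𝒜.pt i j : ℝ)]
    _ ≤ ∑ i, ∑ j, |(𝒜.pt i j : ℝ)| :=
        single_le_sum (f := fun i => ∑ j, |(𝒜.pt i j : ℝ)|)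
          (fun _ _ => sum_nonneg fun _ _ => abs_nonneg _) (mem_univ i)

/-- Lifts of degrees can be translated by any real linear functional in the limit. -/
theorem exists_dualMap_tendsto {v : ℕ → Fin n → ℤ} {t : ℕ → ℝ} (ht : Tendsto t atTop atTop)
    {u : Fin n → ℝ} (hv : ∀ i, Tendsto (fun k => (v k i : ℝ) / t k) atTop (𝓝 (u i)))
    (m : Fin d → ℝ) : ∃ q : ℕ → Fin d → ℤ, ∀ i,
      Tendsto (fun k => ((v k - 𝒜.dualMap (q k)) i : ℝ) / t k) atTop
        (𝓝 (u i - m ⬝ᵥ toReal (𝒜.pt i))) := by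
  obtain ⟨B, hB⟩ := exists_dualMap_near 𝒜
  choose q hq using fun k => hB (t k • m)
  refine ⟨q, fun i => ?_⟩
  have herr : Tendsto (fun k => ((t k • m) ⬝ᵥ toReal (𝒜.pt i) - (𝒜.dualMap (q k) i : ℝ)) / t k)
      atTop (𝓝 0) := by
    refine squeeze_zero_norm' (a := fun k => B / t k) ?_ (tendsto_const_nhds.div_atTop ht)
    filter_upwards [ht.eventually_gt_atTop 0] with k hk
    rw [Real.norm_eq_abs, abs_div, abs_of_pos hk]
    gcongr
    exact hq k i
  have h := ((hv i).sub_const (m ⬝ᵥ toReal (𝒜.pt i))).add herr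
  rw [add_zero] at h
  refine h.congr' ?_
  filter_upwards [ht.eventually_gt_atTop 0] with k hk
  simp only [smul_dotProduct, smul_eq_mul, Pi.sub_apply, Int.cast_sub]
  field_simp
  ring

/-- The functional that witnesses the failure of Euler-tightness can be chosen to differ from `u` at
every point. This makes the signs of `u - m` stable under small perturbations. -/
theorem Phase.exists_of_not_eulerTight {u : Fin n → ℝ} (hu : ¬ P.EulerTight u) :
    ∃ m : Fin d → ℝ, (∀ i, u i ≠ m ⬝ᵥ toReal (𝒜.pt i)) ∧
      ∑ τ ∈ faces P.simplex, (if τ ⊆ univ.filter (fun i => u i < m ⬝ᵥ toReal (𝒜.pt i))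
        then (-1 : ℤ) ^ τ.card else 0) ≠
      if univ.filter (fun i => u i < m ⬝ᵥ toReal (𝒜.pt i)) = ∅ then 1 else 0 := by
  simp only [Phase.EulerTight, not_forall] at hu
  obtain ⟨m, hm⟩ := hu
  -- Lowering `m` by a small constant keeps the strict inequalities and removes the equalities.
  have hev (i : Fin n) : ∀ᶠ ε : ℝ in 𝓝[>] 0, u i ≠ m ⬝ᵥ toReal (𝒜.pt i) - ε ∧
      (u i < m ⬝ᵥ toReal (𝒜.pt i) - ε ↔ u i < m ⬝ᵥ toReal (𝒜.pt i)) := by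
    rcases lt_or_ge (u i) (m ⬝ᵥ toReal (𝒜.pt i)) with h | h
    · filter_upwards [mem_nhdsWithin_of_mem_nhds (Iio_mem_nhds (sub_pos.2 h))] with ε hε
      have : u i < m ⬝ᵥ toReal (𝒜.pt i) - ε := lt_sub_comm.1 hε
      exact ⟨this.ne, by simp [this, h]⟩
    · filter_upwards [self_mem_nhdsWithin] with ε hε
      have : m ⬝ᵥ toReal (𝒜.pt i) - ε < u i := (sub_lt_self _ hε).trans_le h
      exact ⟨this.ne', by simp [this.not_gt, h.not_gt]⟩
  obtain ⟨ε, hε⟩ := (eventually_all.2 hev).exists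
  have hs (i) : (m - Pi.single 0 ε) ⬝ᵥ toReal (𝒜.pt i) = m ⬝ᵥ toReal (𝒜.pt i) - ε := by
    simp [sub_dotProduct, toReal_pt_zero]
  refine ⟨m - Pi.single 0 ε, fun i => ?_, ?_⟩
  · rw [hs]
    exact (hε i).1
  · simp only [hs, (hε _).2]
    exact hm

/-- Degrees that go to infinity in a direction that is not Euler-tight are eventually not acyclic:
after a translation by an integral functional the signs of the lifts are those of `u - m`. -/
theorem Phase.eventually_not_isAcyclic {v : ℕ → Fin n → ℤ} {t : ℕ → ℝ}
    (ht : Tendsto t atTop atTop) {u : Fin n → ℝ}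
    (hv : ∀ i, Tendsto (fun k => (v k i : ℝ) / t k) atTop (𝓝 (u i))) (hu : ¬ P.EulerTight u) :
    ∀ᶠ k in atTop, ¬ P.IsAcyclic (𝒜.Φ (v k)) := by
  obtain ⟨m, hne, hm⟩ := P.exists_of_not_eulerTight hu
  obtain ⟨q, hq⟩ := exists_dualMap_tendsto (𝒜 := 𝒜) ht hv m
  have hsign (i : Fin n) : ∀ᶠ k in atTop,
      ((v k - 𝒜.dualMap (q k)) i < 0 ↔ u i < m ⬝ᵥ toReal (𝒜.pt i)) := by
    rcases lt_or_gt_of_ne (hne i) with h | h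
    · filter_upwards [(hq i).eventually_lt_const (sub_neg.2 h), ht.eventually_gt_atTop 0]
        with k hk htk
      rw [div_neg_iff] at hk
      simp only [h, iff_true]
      have : ((v k - 𝒜.dualMap (q k)) i : ℝ) < 0 := by grind
      exact_mod_cast this
    · filter_upwards [(hq i).eventually_const_lt (sub_pos.2 h), ht.eventually_gt_atTop 0]
        with k hk htk
      rw [div_pos_iff] at hk
      simp only [h.not_gt, iff_false, not_lt]
      have : (0 : ℝ) < (v k - 𝒜.dualMap (q k)) i := by grind
      exact_mod_cast this.le
  filter_upwards [eventually_all.2 hsign] with k hk hac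
  rw [← Φ_sub_dualMap (v k) (q k)] at hac
  have := hac.sum_faces
  simp only [hk] at this
  exact hm this

/-- The maximum of the absolute values of the coordinates. -/
def supAbs (v : Fin n → ℤ) : ℕ := univ.sup fun i => (v i).natAbs

theorem abs_le_supAbs (v : Fin n → ℤ) (i : Fin n) : |v i| ≤ supAbs v := by
  rw [Int.abs_eq_natAbs]
  exact_mod_cast le_sup (f := fun i => (v i).natAbs) (mem_univ i)

theorem tendsto_supAbs : Tendsto (supAbs (n := n)) cofinite atTop := by
  refine tendsto_atTop.2 fun b => ?_
  refine (Set.finite_Icc (fun _ : Fin n => -(b : ℤ)) (fun _ => (b : ℤ))).subset fun v hv => ?_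
  have hv : supAbs v < b := not_le.1 hv
  have h (i) := abs_le.1 ((abs_le_supAbs v i).trans (Nat.cast_le.2 hv.le))
  exact ⟨fun i => (h i).1, fun i => (h i).2⟩

theorem exists_minimal_lift (δ : 𝒜.D) : ∃ v : Fin n → ℤ, 𝒜.Φ v = δ ∧
    ∀ w, 𝒜.Φ w = δ → supAbs v ≤ supAbs w := by
  obtain ⟨v, hv, hmin⟩ := exists_minimalFor_of_wellFoundedLT (fun v => 𝒜.Φ v = δ) supAbs
    (Submodule.mkQ_surjective _ δ)
  exact ⟨v, hv, fun w hw => (le_total _ _).elim id fun h => hmin hw h⟩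

theorem Phase.finite_isAcyclic_neg (P : Phase 𝒜) :
    {δ : 𝒜.D | P.IsAcyclic δ ∧ P.IsAcyclic (-δ)}.Finite := by
  by_contra hinf
  let e := Set.Infinite.natEmbedding _ hinf
  choose l hl hmin using exists_minimal_lift (𝒜 := 𝒜)
  let v : ℕ → Fin n → ℤ := fun k => l (e k).1
  have hvinj : Function.Injective v := fun a b h => by
    have := congrArg 𝒜.Φ h
    simp only [v, hl] at this
    exact e.injective (Subtype.ext this)
  have hv : Tendsto (fun k => (supAbs (v k) : ℝ)) atTop atTop :=
    tendsto_natCast_atTop_atTop.comp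
      (tendsto_supAbs.comp (Nat.cofinite_eq_atTop ▸ hvinj.tendsto_cofinite))
  let y : ℕ → Fin n → ℝ := fun k i => v k i / supAbs (v k)
  have hy (k) : y k ∈ Metric.closedBall (0 : Fin n → ℝ) 1 := by
    rw [mem_closedBall_zero_iff, pi_norm_le_iff_of_nonneg zero_le_one]
    intro i
    rw [Real.norm_eq_abs, abs_div, Nat.abs_cast]
    refine div_le_one_of_le₀ ?_ (Nat.cast_nonneg _)
    exact_mod_cast abs_le_supAbs (v k) i
  obtain ⟨u, -, φ, hφ, hu⟩ := (isCompact_closedBall (0 : Fin n → ℝ) 1).tendsto_subseq hy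
  have ht := hv.comp hφ.tendsto_atTop
  have hu' := tendsto_pi_nhds.1 hu
  by_cases h1 : P.EulerTight u
  · by_cases h2 : P.EulerTight (-u)
    · -- If `u` were linear, translating the lifts would contradict their minimality.
      obtain ⟨m, hm⟩ := h1.exists_eq_dotProduct h2
      obtain ⟨q, hq⟩ := exists_dualMap_tendsto (𝒜 := 𝒜) (v := v ∘ φ) ht hu' m
      have hev (i : Fin n) : ∀ᶠ k in atTop,
          |((v (φ k) - 𝒜.dualMap (q k)) i : ℝ) / supAbs (v (φ k))| < 1 := by
        have := (hq i).abs
        rw [hm, sub_self, abs_zero] at this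
        exact this.eventually_lt_const one_pos
      obtain ⟨k, hk, hpos⟩ := ((eventually_all.2 hev).and (ht.eventually_gt_atTop 0)).exists
      have hpos : (0 : ℝ) < supAbs (v (φ k)) := hpos
      have hlt : supAbs (v (φ k) - 𝒜.dualMap (q k)) < supAbs (v (φ k)) := by
        refine (Finset.sup_lt_iff (by exact_mod_cast hpos)).2 fun i _ => ?_
        have := hk i
        rw [abs_div, Nat.abs_cast, div_lt_one hpos] at this
        zify
        exact_mod_cast this
      exact hlt.not_ge (hmin _ _ (by rw [Φ_sub_dualMap, hl]))
    · have hneg (i) : Tendsto (fun k => ((-v (φ k)) i : ℝ) / supAbs (v (φ k))) atTop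
          (𝓝 ((-u) i)) := by
        simpa [neg_div, y] using (hu' i).neg
      obtain ⟨k, hk⟩ := (P.eventually_not_isAcyclic (v := fun k => -v (φ k)) ht hneg h2).exists
      refine hk ?_
      rw [map_neg, hl]
      exact (e (φ k)).2.2
  · obtain ⟨k, hk⟩ := (P.eventually_not_isAcyclic (v := v ∘ φ) ht hu' h1).exists
    refine hk ?_
    simp only [Function.comp_apply, v, hl]
    exact (e (φ k)).2.1

end Asymptotics

end ToricPhase

theorem mainTheorem1 {d n : ℕ} [NeZero d] (𝒜 : ToricPhase.PointSet d n)
    (P : ToricPhase.Phase 𝒜) :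
    {δ : 𝒜.D | P.IsAcyclic δ ∧ P.IsAcyclic (-δ)}.Finite ∧
    ∀ T : ℕ, (Quotient.mk (ToricPhase.trivialSetoid 𝒜.D T) ''
      {α : Fin T → 𝒜.D | ∀ i j, P.IsAcyclic (α i - α j)}).Finite := by
  refine ⟨P.finite_isAcyclic_neg, fun T => ?_⟩
  cases T with
  | zero => exact (Set.toFinite _).image _
  | succ T =>
    -- Shifting by `-α 0` moves every member of the family into the finite set of the first part.
    refine ((Set.Finite.pi' fun _ : Fin (T + 1) => P.finite_isAcyclic_neg).image
      (Quotient.mk _)).subset ?_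
    rintro _ ⟨α, hα, rfl⟩
    refine ⟨fun i => α i - α 0, fun i => ⟨hα i 0, by rw [neg_sub]; exact hα 0 i⟩, ?_⟩
    exact Quotient.sound ⟨1, α 0, fun i => by simp⟩
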